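/- Let $\tau_d=\{R_0,R_1,R_2,R_3,R_4\}$ be the relational vocabulary with $R_0,R_1,R_2$ binary and $R_3,R_4$ unary. For a $\tau_d$-structure $\mathcal M$ with universe $M$, let $\Omega(\mathcal M)$ be the set of all $\eta\in 2^\omega$ for which there is an $a\in M$ such that $R_4(a)$ holds and, for every $n<\omega$, there are $y_0,\dots,y_n\in M$ with $R_3(y_0)$; $R_4(y_i)$ and $R_2(y_i,a)$ for all $i\le n$; and $R_{\eta(i)}(y_i,y_{i+1})$ for all $i<n$. A set $X\subseteq 2^\omega$ is called dense if every $s\in 2^{<\omega}$ is an initial segment of some member of $X$. For $A\subseteq 2^\omega$, let $Q_A$ be the Lindström quantifier given by the class of all $\tau_d$-structures $\mathcal M$ such that $\Omega(\mathcal M)\setminus A$ is dense. We say that $Q_A$ is $\Sigma^1_1$-definable if there is an existential second order sentence $\exists S_0\cdots\exists S_{k-1}\,\varphi$ (where $S_0,\dots,S_{k-1}$ are finitely many relation symbols and $\varphi$ is a first order sentence in the vocabulary $\tau_d\cup\{S_0,\dots,S_{k-1}\}$) that is true in exactly those (non-empty) $\tau_d$-structures that belong to this class. Theorem. There is a countable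 set $A_0\subseteq 2^\omega$ such that, whenever $A_0\subseteq A\subseteq 2^\omega$ and $2^\omega\setminus A$ is dense, the quantifier $Q_A$ is not $\Sigma^1_1$-definable. -/

import Mathlib

universe u

namespace DensityLogic

/-! ### Existential second order logic -/

/-- The purely relational vocabulary with `k` relation symbols, the `i`-th one of arity `ar i`. -/
def relVocabulary {k : ℕ} (ar : Fin k → ℕ) : FirstOrder.Language.{0, 0} where
  Functions := fun _ => Empty
  Relations := fun n => {i : Fin k // ar i = n}

/-- A `Σ¹₁`-sentence `∃ S₀ … ∃ S₍ₖ₋₁₎ φ` of the vocabulary `L`: the `Sᵢ` are finitely many new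
relation symbols and `φ` is a first order sentence of the vocabulary `L ∪ {S₀, …, S₍ₖ₋₁₎}`. -/
structure SigmaOneOneSentence (L : FirstOrder.Language.{0, 0}) where
  /-- the number of quantified relation symbols -/
  numRels : ℕ
  /-- their arities -/
  arity : Fin numRels → ℕ
  /-- the first order part -/
  matrix : (L.sum (relVocabulary arity)).Sentence

/-- Truth of a `Σ¹₁`-sentence in an `L`-structure: some interpretation of the quantified relation
symbols on `M` makes the first order part true in the expanded structure. -/
def SigmaOneOneSentence.Holds {L : FirstOrder.Language.{0, 0}} (φ : SigmaOneOneSentence L)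
    (M : Type*) [L.Structure M] : Prop :=
  ∃ _S : (relVocabulary φ.arity).Structure M, FirstOrder.Language.Sentence.Realize M φ.matrix

/-! ### Branches represented in a structure -/

/-- The relation symbols of `τ_d`: `R₀, R₁, R₂` are binary, `R₃, R₄` are unary. -/
inductive TauRel : ℕ → Type
  | r0 : TauRel 2
  | r1 : TauRel 2
  | r2 : TauRel 2
  | r3 : TauRel 1
  | r4 : TauRel 1

/-- The vocabulary `τ_d = {R₀, R₁, R₂, R₃, R₄}`. -/
def tauD : FirstOrder.Language.{0, 0} where
  Functions := fun _ => Empty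
  Relations := TauRel

section

variable {M : Type*} [tauD.Structure M]

/-- `R_b(x, y)` for a digit `b`, with `false` and `true` in the roles of `0` and `1`. -/
def Succ : Bool → M → M → Prop
  | false, x, y => FirstOrder.Language.Structure.RelMap (L := tauD) TauRel.r0 ![x, y]
  | true, x, y => FirstOrder.Language.Structure.RelMap (L := tauD) TauRel.r1 ![x, y]

/-- `R₂(x, y)`. -/
def Below (x y : M) : Prop :=
  FirstOrder.Language.Structure.RelMap (L := tauD) TauRel.r2 ![x, y]

/-- `R₃(x)`. -/
def Root (x : M) : Prop :=
  FirstOrder.Language.Structure.RelMap (L := tauD) TauRel.r3 ![x]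

/-- `R₄(x)`. -/
def Dom (x : M) : Prop :=
  FirstOrder.Language.Structure.RelMap (L := tauD) TauRel.r4 ![x]

/-- `M ⊨ ψ_η(x)` for `η ∈ 2ⁿ`: `R₄(x)`, and there are `y₀, …, yₙ` in `R₄` with `R₃(y₀)`,
`R_{η(i)}(yᵢ, yᵢ₊₁)` for `i < n`, and `R₂(yᵢ, x)` for `i ≤ n`. -/
def Represents {n : ℕ} (η : Fin n → Bool) (x : M) : Prop :=
  Dom x ∧ ∃ y : Fin (n + 1) → M, Root (y 0) ∧ (∀ i, Dom (y i)) ∧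
    (∀ i : Fin n, Succ (η i) (y i.castSucc) (y i.succ)) ∧ ∀ i, Below (y i) x

end

/-- `Ω(M)`: the set of all `η ∈ 2^ω` such that some single `a ∈ M` represents `η ↾ n` for all
`n < ω`. -/
def Omega (M : Type*) [tauD.Structure M] : Set (ℕ → Bool) :=
  {η | ∃ a : M, ∀ n : ℕ, Represents (fun i : Fin n => η i) a}

/-- A set `A ⊆ 2^ω` is dense if every `s ∈ 2^{<ω}` is an initial segment of a member of `A`. -/
def IsDense (A : Set (ℕ → Bool)) : Prop :=
  ∀ (n : ℕ) (s : Fin n → Bool), ∃ η ∈ A, ∀ i : Fin n, η i = s i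

/-! ### The quantifier `Q_A` and its definability -/

/-- The Lindström quantifier `Q_A`, given by its class of `τ_d`-structures: `M` belongs to it if and
only if `Ω(M) \ A` is dense. Thus `(Q_A x₀x₁)(ψ₀, …, ψ₄)` is true in a structure with universe `M`
if and only if `M`, with `R₀, …, R₄` interpreted as the relations that `ψ₀, …, ψ₄` define on it,
belongs to the class. -/
def QuantifierClass (A : Set (ℕ → Bool)) (M : Type*) [tauD.Structure M] : Prop :=
  IsDense (Omega M \ A)

/-- `Q_A` is `Σ¹₁`-definable: some `Σ¹₁`-sentence of the vocabulary `τ_d` is true in exactly those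
(non-empty) `τ_d`-structures that belong to the class of `Q_A`, in other words, is equivalent to
`(Q_A x₀x₁)(R₀(x₀,x₁), R₁(x₀,x₁), R₂(x₀,x₁), R₃(x₀), R₄(x₀))`. -/
def IsSigmaOneOneDefinable (A : Set (ℕ → Bool)) : Prop :=
  ∃ φ : SigmaOneOneSentence tauD, ∀ (M : Type u) [tauD.Structure M] [Nonempty M],
    φ.Holds M ↔ QuantifierClass A M

end DensityLogic

namespace DensityLogic

/-! ### There are only countably many `Σ¹₁`-sentences -/

/-! The argument diagonalises over the sentences; of `Σ¹₁`-logic it uses only that there are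
countably many of them (`countable_sigmaOneOneSentence`). Every `X ⊆ 2^ω` is realised as `Omega` of
a structure, the binary tree topped by `X` (`BranchTree.omega_eq`). For each sentence `φ` fix a
countable `X φ` whose tree satisfies `φ`, if any countable set has such a tree, and let `A₀` be the
union of the `X φ`. If `φ` defined `Q_A`, it would hold in the tree over a countable dense `Y ⊆ Aᶜ`,
hence in the tree over `X φ`; but `X φ ⊆ A` leaves no branch outside `A`. -/

theorem countable_sentence (L : FirstOrder.Language.{0, 0}) [Countable L.Symbols] :
    Countable L.Sentence := by
  have hcard : Cardinal.mk (Σ n, L.BoundedFormula Empty n) ≤ Cardinal.aleph0 := by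
    refine FirstOrder.Language.BoundedFormula.card_le.trans (max_le le_rfl ?_)
    have hL : L.card ≤ Cardinal.aleph0 := Cardinal.mk_le_aleph0_iff.mpr inferInstance
    simpa using hL
  have : Countable (Σ n, L.BoundedFormula Empty n) := Cardinal.mk_le_aleph0_iff.mp hcard
  exact Function.Injective.countable (f := fun φ : L.Sentence =>
    (⟨0, φ⟩ : Σ n, L.BoundedFormula Empty n)) fun _ _ h => by simpa using h

theorem countable_symbols_sum (L L' : FirstOrder.Language.{0, 0}) [Countable L.Symbols]
    [Countable L'.Symbols] : Countable (L.sum L').Symbols := by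
  rw [← Cardinal.mk_le_aleph0_iff]
  change (L.sum L').card ≤ Cardinal.aleph0
  have hL : L.card ≤ Cardinal.aleph0 := Cardinal.mk_le_aleph0_iff.mpr inferInstance
  have hL' : L'.card ≤ Cardinal.aleph0 := Cardinal.mk_le_aleph0_iff.mpr inferInstance
  rw [FirstOrder.Language.card_sum]
  simpa using And.intro hL hL'

instance countable_symbols_relVocabulary {k : ℕ} (ar : Fin k → ℕ) :
    Countable (relVocabulary ar).Symbols := by
  have hf : ∀ n, Countable ((relVocabulary ar).Functions n) := fun _ =>
    inferInstanceAs (Countable Empty)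
  have hr : ∀ n, Countable ((relVocabulary ar).Relations n) := fun n =>
    inferInstanceAs (Countable {i : Fin k // ar i = n})
  exact inferInstanceAs (Countable ((Σ n, (relVocabulary ar).Functions n) ⊕
    Σ n, (relVocabulary ar).Relations n))

theorem countable_tauRel (n : ℕ) : Countable (TauRel n) := by
  refine Function.Injective.countable (β := ℕ) (f := fun r => match r with
    | .r0 => 0 | .r1 => 1 | .r2 => 2 | .r3 => 3 | .r4 => 4) ?_
  intro r s h
  cases r <;> cases s <;> simp_all

instance countable_symbols_tauD : Countable tauD.Symbols := by
  have hf : ∀ n, Countable (tauD.Functions n) := fun _ => inferInstanceAs (Countable Empty)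
  have hr : ∀ n, Countable (tauD.Relations n) := countable_tauRel
  exact inferInstanceAs (Countable ((Σ n, tauD.Functions n) ⊕ Σ n, tauD.Relations n))

theorem countable_sigmaOneOneSentence (L : FirstOrder.Language.{0, 0}) [Countable L.Symbols] :
    Countable (SigmaOneOneSentence L) := by
  have hs : ∀ k (ar : Fin k → ℕ), Countable (L.sum (relVocabulary ar)).Sentence := fun k ar =>
    have := countable_symbols_sum L (relVocabulary ar)
    countable_sentence _
  refine Function.Injective.countable (f := fun φ : SigmaOneOneSentence L =>
    (⟨φ.numRels, φ.arity, φ.matrix⟩ :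
      Σ (k : ℕ) (ar : Fin k → ℕ), (L.sum (relVocabulary ar)).Sentence)) ?_
  rintro ⟨k, ar, φ⟩ ⟨k', ar', φ'⟩ h
  simp only [Sigma.mk.injEq] at h
  obtain ⟨rfl, h⟩ := h
  simp only [heq_eq_eq, Sigma.mk.injEq] at h
  obtain ⟨rfl, h⟩ := h
  simp_all

/-! ### Dense sets -/

/-- One witness for each finite sequence suffices. Only countable sets compete in the choice of `X
φ`, so that `A₀` stays countable. -/
theorem IsDense.exists_countable_subset {B : Set (ℕ → Bool)} (hB : IsDense B) :
    ∃ X ⊆ B, X.Countable ∧ IsDense X := by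
  choose f hfB hf using hB
  refine ⟨Set.range fun s : Σ n, Fin n → Bool => f s.1 s.2, ?_, Set.countable_range _, ?_⟩
  · rintro _ ⟨s, rfl⟩
    exact hfB _ _
  · exact fun n s => ⟨f n s, ⟨⟨n, s⟩, rfl⟩, hf n s⟩

theorem not_isDense_empty : ¬ IsDense ∅ := fun h =>
  let ⟨_, hη, _⟩ := h 0 Fin.elim0
  hη

/-! ### The binary tree with a prescribed set of branches on top -/

/-- The finite binary sequences together with the members of `X`. -/
def BranchTree (X : Set (ℕ → Bool)) : Type u :=
  ULift.{u} (List Bool ⊕ X)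

namespace BranchTree

variable {X : Set (ℕ → Bool)}

/-- A finite sequence as an element of the tree. -/
def node (l : List Bool) : BranchTree.{u} X := ⟨Sum.inl l⟩

/-- A member of `X` as an element on top of the tree. -/
def top (ξ : X) : BranchTree.{u} X := ⟨Sum.inr ξ⟩

theorem node_injective : Function.Injective (node : List Bool → BranchTree.{u} X) :=
  fun _ _ h => Sum.inl_injective (ULift.up_injective h)

theorem top_injective : Function.Injective (top : X → BranchTree.{u} X) :=
  fun _ _ h => Sum.inr_injective (ULift.up_injective h)

instance : Nonempty (BranchTree.{u} X) := ⟨node []⟩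

/-- The first `n` digits of `η`. -/
def initialSegment (η : ℕ → Bool) (n : ℕ) : List Bool := (List.range n).map η

theorem initialSegment_succ (η : ℕ → Bool) (n : ℕ) :
    initialSegment η (n + 1) = initialSegment η n ++ [η n] := by
  simp [initialSegment, List.range_succ]

theorem initialSegment_injective : Function.Injective initialSegment := by
  intro η ξ h
  funext n
  have hn := congrFun h (n + 1)
  rw [initialSegment_succ, initialSegment_succ, congrFun h n] at hn
  simpa using hn

/-- `R₀` and `R₁` are the two successor relations, `R₂` is the relation between a branch and its
initial segments, `R₃` holds of the empty sequence only, and `R₄` holds everywhere. -/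
instance : tauD.Structure (BranchTree.{u} X) where
  funMap f := Empty.elim f
  RelMap r v := match r, v with
    | TauRel.r0, v => ∃ l, v 0 = node l ∧ v 1 = node (l ++ [false])
    | TauRel.r1, v => ∃ l, v 0 = node l ∧ v 1 = node (l ++ [true])
    | TauRel.r2, v => ∃ (ξ : X) (n : ℕ), v 0 = node (initialSegment ξ n) ∧ v 1 = top ξ
    | TauRel.r3, v => v 0 = node []
    | TauRel.r4, _ => True

theorem succ_iff {b : Bool} {x y : BranchTree.{u} X} :
    Succ b x y ↔ ∃ l, x = node l ∧ y = node (l ++ [b]) := by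
  cases b <;> rfl

theorem below_iff {x y : BranchTree.{u} X} :
    Below x y ↔ ∃ (ξ : X) (n : ℕ), x = node (initialSegment ξ n) ∧ y = top ξ := Iff.rfl

theorem root_iff {x : BranchTree.{u} X} : Root x ↔ x = node [] := Iff.rfl

theorem dom (x : BranchTree.{u} X) : Dom x := trivial

theorem represents_top (ξ : X) (n : ℕ) :
    Represents (fun i : Fin n => (ξ : ℕ → Bool) i) (top ξ : BranchTree.{u} X) :=
  ⟨dom _, fun i => node (initialSegment ξ i), root_iff.mpr rfl, fun _ => dom _,
    fun i => succ_iff.mpr ⟨_, rfl, congrArg node (initialSegment_succ ξ i)⟩,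
    fun i => below_iff.mpr ⟨ξ, i, rfl, rfl⟩⟩

/-- The root and successor relations leave no freedom: `y i` must be the initial segment of `η` of
length `i`. Then `Below` at the last index forces `a` to be a top, and comparing lengths matches the
segments. -/
theorem exists_eq_top_of_represents {η : ℕ → Bool} {n : ℕ} {a : BranchTree.{u} X}
    (h : Represents (fun i : Fin n => η i) a) :
    ∃ ξ : X, a = top ξ ∧ initialSegment η n = initialSegment ξ n := by
  obtain ⟨-, y, h_root, -, h_succ, h_below⟩ := h
  have hy : ∀ i : Fin (n + 1), y i = node (initialSegment η i) := by
    intro i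
    induction i using Fin.induction with
    | zero => exact root_iff.mp h_root
    | succ i ih =>
      obtain ⟨l, hl, hl'⟩ := succ_iff.mp (h_succ i)
      have : initialSegment η i = l := node_injective (ih.symm.trans hl)
      rw [hl', ← this]
      exact congrArg node (initialSegment_succ η i).symm
  obtain ⟨ξ, m, hm, ha⟩ := below_iff.mp (h_below (Fin.last n))
  have heq : initialSegment η n = initialSegment ξ m :=
    node_injective ((hy (Fin.last n)).symm.trans hm)
  have hlen : n = m := by simpa [initialSegment] using congrArg List.length heq
  subst hlen
  exact ⟨ξ, ha, heq⟩

theorem omega_eq (X : Set (ℕ → Bool)) : Omega (BranchTree.{u} X) = X := by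
  ext η
  constructor
  · rintro ⟨a, ha⟩
    -- Length `0` already forces `a` to be a top; this fixes one `ξ` for all `n`.
    obtain ⟨ξ, rfl, -⟩ := exists_eq_top_of_represents (ha 0)
    suffices η = ξ from this ▸ ξ.2
    refine initialSegment_injective (funext fun n => ?_)
    obtain ⟨ξ', hξ', h⟩ := exists_eq_top_of_represents (ha n)
    rwa [top_injective hξ']
  · exact fun hη => ⟨top ⟨η, hη⟩, represents_top ⟨η, hη⟩⟩

end BranchTree

end DensityLogic

open DensityLogic in
theorem mainTheorem8 :
    ∃ A₀ : Set (ℕ → Bool), A₀.Countable ∧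
      ∀ A : Set (ℕ → Bool), A₀ ⊆ A → DensityLogic.IsDense Aᶜ →
        ¬ DensityLogic.IsSigmaOneOneDefinable.{u} A := by
  -- The choice depends on `φ` alone, not on `A`; the empty set is a dummy value when no countable
  -- `Y` works.
  have h_choice : ∀ φ : SigmaOneOneSentence tauD, ∃ X : Set (ℕ → Bool), X.Countable ∧
      ((∃ Y : Set (ℕ → Bool), Y.Countable ∧ φ.Holds (BranchTree.{u} Y)) →
        φ.Holds (BranchTree.{u} X)) := by
    intro φ
    by_cases h : ∃ Y : Set (ℕ → Bool), Y.Countable ∧ φ.Holds (BranchTree.{u} Y)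
    · obtain ⟨Y, hY, hφ⟩ := h
      exact ⟨Y, hY, fun _ => hφ⟩
    · exact ⟨∅, Set.countable_empty, fun h' => absurd h' h⟩
  choose X hX hXφ using h_choice
  have := countable_sigmaOneOneSentence tauD
  refine ⟨⋃ φ, X φ, Set.countable_iUnion hX, ?_⟩
  rintro A hA hAc ⟨φ, hφ⟩
  obtain ⟨Y, hYA, hY, hYd⟩ := hAc.exists_countable_subset
  have hφY : φ.Holds (BranchTree.{u} Y) := by
    rw [hφ, QuantifierClass, BranchTree.omega_eq]
    rwa [sdiff_eq_left.mpr (Set.subset_compl_iff_disjoint_right.mp hYA)]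
  have hd := (hφ (BranchTree.{u} (X φ))).mp (hXφ φ ⟨Y, hY, hφY⟩)
  rw [QuantifierClass, BranchTree.omega_eq,
    Set.sdiff_eq_empty.mpr ((Set.subset_iUnion X φ).trans hA)] at hd
  exact not_isDense_empty hd
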